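/- A groupoid is a set $A$ (of any cardinality) with one binary operation, written $xy$; its dual is the groupoid on $A$ with operation $(x,y)\mapsto yx$. A clone on $A$ is a set of finitary operations on $A$ that contains all projections and is closed under composition; the clone of a groupoid is the set of its term operations. A clone is minimal if it is an atom of the lattice of clones on $A$ ordered by inclusion, i.e. if it is not the clone of all projections and its only proper subclone is the clone of all projections. Let $\mathcal{B}$ be the variety of groupoids defined by the identities $$xx\approx x,\qquad x(xy)\approx x(yx)\approx (xy)x\approx (xy)y\approx (xy)(yx)\approx xy.$$ Theorem. Let $\mathbb{A}$ be a Szász–Hájek groupoid, i.e. a groupoid in which there is exactly one triple $(a,b,c)$ with $(ab)c\neq a(bc)$. Then the following two conditions are equivalent: (i) the clone of $\mathbb{A}$ is minimal; (ii) $\mathbb{A}$ or its dual belongs to the variety $\mathcal{B}$. -/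

import Mathlib

universe u

/-- A clone on `A`: a set of finitary operations on `A` that contains all projections and is
closed under composition. `ops n` is the set of its operations of arity `n + 1`; as usual, clones
have no operations of arity `0`. -/
@[ext]
structure OpClone (A : Type u) where
  ops : ∀ n : ℕ, Set ((Fin (n + 1) → A) → A)
  proj_mem : ∀ (n : ℕ) (i : Fin (n + 1)), (fun x => x i) ∈ ops n
  comp_mem : ∀ (m n : ℕ) (g : (Fin (m + 1) → A) → A)
    (h : Fin (m + 1) → (Fin (n + 1) → A) → A),
    g ∈ ops m → (∀ i, h i ∈ ops n) → (fun x => g (fun i => h i x)) ∈ ops n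

namespace OpClone

/-- Clones on `A` are ordered by inclusion. -/
instance (A : Type u) : PartialOrder (OpClone A) where
  le C D := ∀ n, C.ops n ⊆ D.ops n
  le_refl _ _ := subset_rfl
  le_trans _ _ _ h k n := (h n).trans (k n)
  le_antisymm _ _ h k := OpClone.ext (funext fun n => (h n).antisymm (k n))

/-- The trivial clone on `A`, which consists of all projections. -/
def trivial (A : Type u) : OpClone A where
  ops n := {g | ∃ i : Fin (n + 1), g = fun x => x i}
  proj_mem _ i := ⟨i, rfl⟩
  comp_mem := by
    rintro m n g h ⟨i, rfl⟩ hh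
    exact hh i

/-- The trivial clone is the least clone on `A`. -/
instance (A : Type u) : OrderBot (OpClone A) where
  bot := trivial A
  bot_le C n := by
    rintro g ⟨i, rfl⟩
    exact C.proj_mem n i

/-- A minimal clone is an atom of the lattice of clones on `A`. -/
def IsMinimal {A : Type u} (C : OpClone A) : Prop := IsAtom C

/-- The clone of a groupoid `A`: the operations induced on `A` by the groupoid terms. A term in
the variables `x₀, …, xₙ` is an element of the free groupoid on `Fin (n + 1)`. -/
def ofGroupoid (A : Type u) [Mul A] : OpClone A where
  ops n := {g | ∃ t : FreeMagma (Fin (n + 1)), g = fun x => FreeMagma.lift x t}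
  proj_mem _ i := ⟨FreeMagma.of i, by simp⟩
  comp_mem := by
    rintro m n g h ⟨t, rfl⟩ hh
    choose s hs using hh
    refine ⟨FreeMagma.lift s t, ?_⟩
    funext x
    induction t with
    | ih1 i => simp [hs i]
    | ih2 a b iha ihb => simp only [map_mul, iha, ihb]

end OpClone

/-- A groupoid has a minimal clone if the clone of its term operations is minimal. -/
def HasMinimalClone (A : Type u) [Mul A] : Prop := (OpClone.ofGroupoid A).IsMinimal

/-- The index of nonassociativity of a groupoid: the number of its nonassociative triples. -/
noncomputable def nonassocIndex (A : Type u) [Mul A] : Cardinal.{u} :=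
  Cardinal.mk {p : A × A × A // (p.1 * p.2.1) * p.2.2 ≠ p.1 * (p.2.1 * p.2.2)}

/-- A Szász–Hájek groupoid has exactly one nonassociative triple. -/
def IsSzaszHajek (A : Type u) [Mul A] : Prop := nonassocIndex A = 1

/-- Membership of a groupoid in the variety `𝓑`, defined by the identities
`xx ≈ x` and `x(xy) ≈ x(yx) ≈ (xy)x ≈ (xy)y ≈ (xy)(yx) ≈ xy`. -/
structure InVarietyB (A : Type u) [Mul A] : Prop where
  idem : ∀ x : A, x * x = x
  left_left : ∀ x y : A, x * (x * y) = x * y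
  left_swap : ∀ x y : A, x * (y * x) = x * y
  right_left : ∀ x y : A, (x * y) * x = x * y
  right_right : ∀ x y : A, (x * y) * y = x * y
  mul_swap : ∀ x y : A, (x * y) * (y * x) = x * y

/-! Over a groupoid in `𝓑`, a term is a projection or turns into `uv` once `u` replaces its leftmost
variable and `v` all others (`lift_eq_proj_or`). So every nontrivial subclone contains the
multiplication.

Conversely, minimality forces idempotence, and the entries of the triple are irreducible where
needed, so removing one of them leaves a band (`pair_of_ne`). In a band, `x(yx)` satisfies the
identities of `𝓑`. Once it does so on all of `A`, minimality gives `xy = x(yx)`, `xy = y(xy)` or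
`x(yx) = x` (`of_sandwich`). If `a, b, c` are distinct, any two elements miss one of them; the first
two alternatives give `𝓑` and its dual, the third a contradiction. A triple `(a,b,a)` is excluded
similarly, after a computation with `a` and `b`. For `(a,a,b)`, the operation `x(xy)` is a band
operation generating the clone, but its few binary terms do not include the multiplication;
`(a,b,b)` is dual. -/

namespace OpClone

/-! ### Clones generated by a binary operation -/

variable {A : Type u}

/-- The clone generated by a binary operation. -/
def ofBinary (m : A → A → A) : OpClone A := @ofGroupoid A ⟨m⟩

theorem ofGroupoid_eq_ofBinary [Mul A] : ofGroupoid A = ofBinary (fun x y : A => x * y) := rfl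

theorem self_mem_ofBinary (m : A → A → A) :
    (fun x : Fin 2 → A => m (x 0) (x 1)) ∈ (ofBinary m).ops 1 :=
  ⟨FreeMagma.of 0 * FreeMagma.of 1, rfl⟩

theorem ofBinary_le_iff {m : A → A → A} {C : OpClone A} :
    ofBinary m ≤ C ↔ (fun x : Fin 2 → A => m (x 0) (x 1)) ∈ C.ops 1 := by
  refine ⟨fun h => h 1 (self_mem_ofBinary m), fun h n => ?_⟩
  rintro _ ⟨t, rfl⟩
  let _ : Mul A := ⟨m⟩
  induction t with
  | ih1 i => exact C.proj_mem n i
  | ih2 s t hs ht =>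
    have := C.comp_mem 1 n _ ![fun x => FreeMagma.lift x s, fun x => FreeMagma.lift x t] h
      (fun i => by fin_cases i; exacts [hs, ht])
    exact this

theorem ofBinary_swap (m : A → A → A) : ofBinary (fun x y => m y x) = ofBinary m :=
  le_antisymm (ofBinary_le_iff.2 ⟨FreeMagma.of 1 * FreeMagma.of 0, rfl⟩)
    (ofBinary_le_iff.2 ⟨FreeMagma.of 1 * FreeMagma.of 0, rfl⟩)

/-- A set of binary operations that contains the projections and is closed under `m` contains all
binary operations of the clone of `m`. -/
theorem mem_of_mem_ofBinary {m : A → A → A} (T : Set (A → A → A))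
    (h₀ : (fun x _ => x) ∈ T) (h₁ : (fun _ y => y) ∈ T)
    (hm : ∀ p ∈ T, ∀ q ∈ T, (fun x y => m (p x y) (q x y)) ∈ T) {g : A → A → A}
    (hg : (fun x : Fin 2 → A => g (x 0) (x 1)) ∈ (ofBinary m).ops 1) : g ∈ T := by
  obtain ⟨t, ht⟩ := hg
  let _ : Mul A := ⟨m⟩
  have key : ∀ t : FreeMagma (Fin 2), (fun x y : A => FreeMagma.lift ![x, y] t) ∈ T := by
    intro t
    induction t with
    | ih1 i => fin_cases i; exacts [h₀, h₁]
    | ih2 s t hs ht => exact hm _ hs _ ht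
  have h : g = fun x y : A => FreeMagma.lift ![x, y] t :=
    funext fun x => funext fun y => congrFun ht ![x, y]
  rw [h]
  exact key t

theorem IsMinimal.trivial_or_eq {m g : A → A → A} (hm : (ofBinary m).IsMinimal)
    (hg : (fun x : Fin 2 → A => g (x 0) (x 1)) ∈ (ofBinary m).ops 1) :
    (∀ x y, g x y = x) ∨ (∀ x y, g x y = y) ∨ ofBinary g = ofBinary m := by
  rcases hm.le_iff.1 (ofBinary_le_iff.2 hg) with h | h
  · have h' := self_mem_ofBinary g
    rw [h] at h'
    obtain ⟨i, hi⟩ := h'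
    fin_cases i
    · exact Or.inl fun x y => congrFun hi ![x, y]
    · exact Or.inr (Or.inl fun x y => congrFun hi ![x, y])
  · exact Or.inr (Or.inr h)

end OpClone

open OpClone

/-- The defining identities of `𝓑` for an explicitly given operation. -/
theorem InVarietyB.of_op {A : Type u} {m : A → A → A} (h : @InVarietyB A ⟨m⟩) :
    (∀ x, m x x = x) ∧ (∀ x y, m x (m x y) = m x y) ∧ (∀ x y, m x (m y x) = m x y) ∧
      (∀ x y, m (m x y) x = m x y) ∧ (∀ x y, m (m x y) y = m x y) ∧
      (∀ x y, m (m x y) (m y x) = m x y) :=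
  let _ : Mul A := ⟨m⟩
  ⟨h.idem, h.left_left, h.left_swap, h.right_left, h.right_right, h.mul_swap⟩

/-- The binary term operations of a groupoid in `𝓑`. -/
theorem InVarietyB.mem_ofBinary {A : Type u} {m g : A → A → A} (h : @InVarietyB A ⟨m⟩)
    (hg : (fun x : Fin 2 → A => g (x 0) (x 1)) ∈ (ofBinary m).ops 1) :
    (∀ x y, g x y = x) ∨ (∀ x y, g x y = y) ∨ (∀ x y, g x y = m x y) ∨
      (∀ x y, g x y = m y x) := by
  have hT := mem_of_mem_ofBinary
    {p | p = (fun x _ => x) ∨ p = (fun _ y => y) ∨ p = m ∨ p = fun x y => m y x}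
    (by simp) (by simp) ?_ hg
  · rcases hT with rfl | rfl | rfl | rfl <;> simp
  · obtain ⟨e₁, e₂, e₃, e₄, e₅, e₆⟩ := h.of_op
    rintro p (rfl | rfl | rfl | rfl) q (rfl | rfl | rfl | rfl) <;>
      simp [e₁, e₂, e₃, e₄, e₅, e₆]

section

variable {A : Type u} [Mul A]

/-- The groupoid operation of the dual, on the same set. -/
abbrev dualMul (A : Type u) [Mul A] : Mul A := ⟨fun x y => y * x⟩

theorem hasMinimalClone_dual_iff : @HasMinimalClone A (dualMul A) ↔ HasMinimalClone A := by
  have h : @ofGroupoid A (dualMul A) = ofGroupoid A := ofBinary_swap (fun x y : A => x * y)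
  unfold HasMinimalClone
  rw [h]

theorem inVarietyB_dual_iff : @InVarietyB A (dualMul A) ↔ InVarietyB (MulOpposite A) := by
  constructor
  · intro h
    obtain ⟨e₁, e₂, e₃, e₄, e₅, e₆⟩ := InVarietyB.of_op (m := fun x y : A => y * x) h
    constructor <;> intros <;> apply MulOpposite.unop_injective
    exacts [e₁ _, e₂ _ _, e₃ _ _, e₄ _ _, e₅ _ _, e₆ _ _]
  · intro h
    refine @InVarietyB.mk A (dualMul A) ?_ ?_ ?_ ?_ ?_ ?_ <;> intros <;>
      apply MulOpposite.op_injective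
    · exact h.idem _
    · exact h.left_left _ _
    · exact h.left_swap _ _
    · exact h.right_left _ _
    · exact h.right_right _ _
    · exact h.mul_swap _ _

/-! ### Minimality of clones of groupoids in `𝓑` -/

namespace InVarietyB

theorem mul_mem_four (h : InVarietyB A) {u v p q : A}
    (hp : p = u ∨ p = v ∨ p = u * v ∨ p = v * u) (hq : q = u ∨ q = v ∨ q = u * v ∨ q = v * u) :
    p * q = u ∨ p * q = v ∨ p * q = u * v ∨ p * q = v * u := by
  rcases hp with rfl | rfl | rfl | rfl <;> rcases hq with rfl | rfl | rfl | rfl <;>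
    simp [h.idem, h.left_left, h.left_swap, h.right_left, h.right_right, h.mul_swap]

/-- The left factor decides: a product starting in `{v, vu}` stays there. -/
theorem mul_mem_right (h : InVarietyB A) {u v p q : A}
    (hp : p = v ∨ p = v * u) (hq : q = u ∨ q = v ∨ q = u * v ∨ q = v * u) :
    p * q = v ∨ p * q = v * u := by
  rcases hp with rfl | rfl <;> rcases hq with rfl | rfl | rfl | rfl <;>
    simp [h.idem, h.left_left, h.left_swap, h.right_left, h.right_right, h.mul_swap]

theorem mul_mem_left (h : InVarietyB A) {u v q : A}
    (hq : q = u ∨ q = v ∨ q = u * v ∨ q = v * u) : u * v * q = u * v := by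
  rcases hq with rfl | rfl | rfl | rfl <;>
    simp [h.idem, h.right_left, h.right_right, h.mul_swap]

theorem lift_mem_four (h : InVarietyB A) {ι : Type*} [DecidableEq ι] (t : FreeMagma ι) (k : ι)
    (u v : A) :
    FreeMagma.lift (fun j => if j = k then u else v) t = u ∨
    FreeMagma.lift (fun j => if j = k then u else v) t = v ∨
    FreeMagma.lift (fun j => if j = k then u else v) t = u * v ∨
    FreeMagma.lift (fun j => if j = k then u else v) t = v * u := by
  induction t with
  | ih1 i => by_cases hi : i = k <;> simp [hi]
  | ih2 s t hs ht => simpa only [map_mul] using h.mul_mem_four hs ht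

/-- In a groupoid in `𝓑`, a term either induces a projection, or becomes the product `u * v` when
`u` is substituted for one variable and `v` for all others. -/
theorem lift_eq_proj_or (h : InVarietyB A) {ι : Type*} [DecidableEq ι] (t : FreeMagma ι) :
    ∃ i : ι, (∀ x : ι → A, FreeMagma.lift x t = x i) ∨
      ((∀ u v : A, FreeMagma.lift (fun j => if j = i then u else v) t = u * v) ∧
        ∀ k ≠ i, ∀ u v : A, FreeMagma.lift (fun j => if j = k then u else v) t = v ∨
          FreeMagma.lift (fun j => if j = k then u else v) t = v * u) := by
  induction t with
  -- The witness is always the leftmost variable of the term.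
  | ih1 i => exact ⟨i, Or.inl fun x => by simp⟩
  | ih2 s t hs ht =>
    obtain ⟨i, hs | ⟨hs, hs'⟩⟩ := hs
    · obtain ⟨j, ht⟩ := ht
      have hk : ∀ k ≠ i, ∀ u v : A,
          FreeMagma.lift (fun j => if j = k then u else v) (s * t) = v ∨
          FreeMagma.lift (fun j => if j = k then u else v) (s * t) = v * u := by
        intro k hk u v
        rw [map_mul, hs, if_neg hk.symm]
        exact h.mul_mem_right (Or.inl rfl) (h.lift_mem_four t k u v)
      rcases eq_or_ne i j with rfl | hij
      · rcases ht with ht | ⟨ht, -⟩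
        · exact ⟨i, Or.inl fun x => by rw [map_mul, hs, ht, h.idem]⟩
        · exact ⟨i, Or.inr ⟨fun u v => by rw [map_mul, hs, ht, if_pos rfl, h.left_left], hk⟩⟩
      · refine ⟨i, Or.inr ⟨fun u v => ?_, hk⟩⟩
        rw [map_mul, hs, if_pos rfl]
        rcases ht with ht | ⟨-, ht⟩
        · rw [ht, if_neg hij.symm]
        · rcases ht i hij u v with ht | ht <;> simp [ht, h.left_swap]
    · refine ⟨i, Or.inr ⟨fun u v => ?_, fun k hk u v => ?_⟩⟩
      · rw [map_mul, hs, h.mul_mem_left (h.lift_mem_four t i u v)]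
      · rw [map_mul]
        exact h.mul_mem_right (hs' k hk u v) (h.lift_mem_four t k u v)

/-- A groupoid in `𝓑` whose operation is not a projection has a minimal clone. -/
theorem hasMinimalClone (h : InVarietyB A) (h₀ : ¬∀ x y : A, x * y = x)
    (h₁ : ¬∀ x y : A, x * y = y) : HasMinimalClone A := by
  refine ⟨fun hbot => ?_, fun C hC => ?_⟩
  · have hm := self_mem_ofBinary (fun x y : A => x * y)
    rw [← ofGroupoid_eq_ofBinary, hbot] at hm
    obtain ⟨i, hi⟩ := hm
    fin_cases i
    · exact h₀ fun x y => congrFun hi ![x, y]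
    · exact h₁ fun x y => congrFun hi ![x, y]
  · by_contra hne
    refine hC.not_ge ?_
    have : ∃ n, ∃ g ∈ C.ops n, ¬∃ i, g = fun x => x i := by
      by_contra! hall
      exact hne (le_bot_iff.1 fun n g hg => hall n g hg)
    obtain ⟨n, g, hg, hproj⟩ := this
    obtain ⟨t, rfl⟩ := hC.le n hg
    obtain ⟨i, ht | ⟨ht, -⟩⟩ := h.lift_eq_proj_or t
    · exact absurd ⟨i, funext ht⟩ hproj
    · rw [ofGroupoid_eq_ofBinary, ofBinary_le_iff]
      have := C.comp_mem n 1 _ (fun j x => if j = i then x 0 else x 1) hg fun j => by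
        by_cases hj : j = i
        · simpa only [hj, if_true] using C.proj_mem 1 0
        · simpa only [hj, if_false] using C.proj_mem 1 1
      simpa only [ht] using this

end InVarietyB

/-- `(a, b, c)` is the only nonassociative triple of the groupoid `A`. -/
structure IsUniqueNonassocTriple (A : Type u) [Mul A] (a b c : A) : Prop where
  ne : a * b * c ≠ a * (b * c)
  assoc : ∀ x y z : A, ¬(x = a ∧ y = b ∧ z = c) → x * y * z = x * (y * z)

theorem IsSzaszHajek.exists_triple (h : IsSzaszHajek A) :
    ∃ a b c : A, IsUniqueNonassocTriple A a b c := by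
  obtain ⟨hs, ⟨⟨⟨a, b, c⟩, habc⟩⟩⟩ := Cardinal.eq_one_iff_unique.1 h
  refine ⟨a, b, c, habc, fun x y z hne => ?_⟩
  by_contra hxyz
  have := congrArg Subtype.val (hs.elim ⟨(x, y, z), hxyz⟩ ⟨(a, b, c), habc⟩)
  simp only [Prod.mk.injEq] at this
  exact hne this

/-! ### The operation `x(yx)` and bands -/

theorem term_mem_left_left :
    (fun x : Fin 2 → A => x 0 * (x 0 * x 1)) ∈ (ofBinary (fun x y : A => x * y)).ops 1 :=
  ⟨FreeMagma.of 0 * (FreeMagma.of 0 * FreeMagma.of 1), rfl⟩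

theorem term_mem_sandwich :
    (fun x : Fin 2 → A => x 0 * (x 1 * x 0)) ∈ (ofBinary (fun x y : A => x * y)).ops 1 :=
  ⟨FreeMagma.of 0 * (FreeMagma.of 1 * FreeMagma.of 0), rfl⟩

/-- The operation `x(yx)` of a groupoid. -/
def sandwich (x y : A) : A := x * (y * x)

/-- If the operation `x(yx)` of a groupoid with a minimal clone defines a groupoid in `𝓑`, then
the groupoid satisfies one of three identities. -/
theorem HasMinimalClone.of_sandwich (hmin : HasMinimalClone A)
    (h : @InVarietyB A ⟨sandwich⟩) :
    (∀ x y : A, x * y = x * (y * x)) ∨ (∀ x y : A, x * y = y * (x * y)) ∨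
      (∀ x y : A, x * (y * x) = x) := by
  rcases IsMinimal.trivial_or_eq (m := fun x y : A => x * y) (g := sandwich) hmin term_mem_sandwich with hg | hg | hg
  · exact Or.inr (Or.inr hg)
  -- If `x(yx)` is the second projection, the identity `left_swap` reads `x = y`.
  · have : Subsingleton A := ⟨fun x y => by
      have e : sandwich x (sandwich y x) = sandwich x y := h.of_op.2.2.1 x y
      rwa [hg, hg, hg] at e⟩
    exact Or.inl fun x y => Subsingleton.elim _ _
  -- The multiplication is now a binary term in `x(yx)`, hence a projection, `x(yx)` or `y(xy)`.
  · have hm := self_mem_ofBinary (fun x y : A => x * y)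
    rw [← hg] at hm
    rcases h.mem_ofBinary hm with e | e | e | e
    · exact Or.inl fun x y => by rw [e y x]
    · exact Or.inr (Or.inl fun x y => by rw [e x y, e y y])
    · exact Or.inl e
    · exact Or.inr (Or.inl e)

/-- The defining identities of `𝓑` for the operation `x(yx)`, at a given pair of elements. -/
structure SandwichB (x y : A) : Prop where
  left_left : sandwich x (sandwich x y) = sandwich x y
  left_swap : sandwich x (sandwich y x) = sandwich x y
  right_left : sandwich (sandwich x y) x = sandwich x y
  right_right : sandwich (sandwich x y) y = sandwich x y
  mul_swap : sandwich (sandwich x y) (sandwich y x) = sandwich x y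

theorem inVarietyB_sandwich (hi : ∀ x : A, x * x = x) (h : ∀ x y : A, SandwichB x y) :
    @InVarietyB A ⟨sandwich⟩ :=
  @InVarietyB.mk A ⟨sandwich⟩ (fun x => by change x * (x * x) = x; rw [hi, hi])
    (fun x y => (h x y).left_left) (fun x y => (h x y).left_swap) (fun x y => (h x y).right_left)
    (fun x y => (h x y).right_right) (fun x y => (h x y).mul_swap)

theorem band_left_left {S : Type*} [Semigroup S] (hi : ∀ x : S, x * x = x) (x y : S) :
    x * (x * y) = x * y := by
  rw [← mul_assoc, hi]

theorem sandwichB_of_band {S : Type*} [Semigroup S] (hi : ∀ x : S, x * x = x) (x y : S) :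
    SandwichB x y := by
  have h₁ := band_left_left hi
  have h₂ : y * (x * (y * x)) = y * x := by rw [← mul_assoc, hi]
  constructor <;> simp only [sandwich, mul_assoc, hi, h₁, h₂]

/-- The binary term operations of a band with a minimal clone. -/
theorem mem_ofBinary_of_band {S : Type u} [Semigroup S] (hi : ∀ x : S, x * x = x)
    (hmin : HasMinimalClone S) {g : S → S → S}
    (hg : (fun x : Fin 2 → S => g (x 0) (x 1)) ∈ (ofBinary (fun x y : S => x * y)).ops 1) :
    (∀ x y, g x y = x) ∨ (∀ x y, g x y = y) ∨ (∀ x y, g x y = x * y) ∨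
      (∀ x y, g x y = y * x) := by
  have hB := band_left_left hi
  rcases hmin.of_sandwich (inVarietyB_sandwich hi (sandwichB_of_band hi)) with e | e | e
  · have h : InVarietyB S := by
      refine ⟨hi, hB, fun x y => (e x y).symm, fun x y => ?_, fun x y => ?_, fun x y => ?_⟩
      · rw [mul_assoc, ← e]
      · rw [mul_assoc, hi]
      · rw [mul_assoc, hB, ← e]
    exact InVarietyB.mem_ofBinary (m := fun x y : S => x * y) h hg
  · have h : @InVarietyB S (dualMul S) := by
      refine @InVarietyB.mk S (dualMul S) ?_ ?_ ?_ ?_ ?_ ?_ <;> intro x <;> try intro y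
      · exact hi x
      · change y * x * x = y * x
        rw [mul_assoc, hi]
      · change x * y * x = y * x
        rw [mul_assoc, ← e]
      · change x * (y * x) = y * x
        rw [← e]
      · change y * (y * x) = y * x
        rw [hB y x]
      · change x * y * (y * x) = y * x
        rw [mul_assoc, hB y x, ← e]
    rw [← ofBinary_swap] at hg
    have := InVarietyB.mem_ofBinary (m := fun x y : S => y * x) h hg
    tauto
  -- Here `xyx = x`: in a rectangular band, `x, y, xy, yx` are closed under products.
  · have hT := mem_of_mem_ofBinary
      {p | p = (fun x _ => x) ∨ p = (fun _ y => y) ∨ p = (fun x y => x * y) ∨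
        p = fun x y => y * x} (by simp) (by simp) ?_ hg
    · rcases hT with rfl | rfl | rfl | rfl <;> simp
    · rintro p (rfl | rfl | rfl | rfl) q (rfl | rfl | rfl | rfl) <;>
        simp [mul_assoc, hi, e, hB]

/-- If the product is associative on a subset closed under multiplication of an idempotent
groupoid, then all pairs of elements of it behave as in a band. -/
theorem pair_of_subsemigroup (hi : ∀ x : A, x * x = x) (H : Subsemigroup A)
    (hH : ∀ x ∈ H, ∀ y ∈ H, ∀ z ∈ H, x * y * z = x * (y * z)) {x y : A} (hx : x ∈ H)
    (hy : y ∈ H) : SandwichB x y ∧ (x * y) * (y * x) = x * (y * x) := by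
  let _ : Semigroup H :=
    { mul_assoc := fun p q r => Subtype.ext (hH p p.2 q q.2 r r.2) }
  have hi' : ∀ p : H, p * p = p := fun p => Subtype.ext (hi p)
  have h := sandwichB_of_band hi' ⟨x, hx⟩ ⟨y, hy⟩
  refine ⟨⟨?_, ?_, ?_, ?_, ?_⟩, ?_⟩
  · exact congrArg Subtype.val h.left_left
  · exact congrArg Subtype.val h.left_swap
  · exact congrArg Subtype.val h.right_left
  · exact congrArg Subtype.val h.right_right
  · exact congrArg Subtype.val h.mul_swap
  · have hb := band_left_left hi' ⟨y, hy⟩ ⟨x, hx⟩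
    have e : (⟨x, hx⟩ * ⟨y, hy⟩ : H) * (⟨y, hy⟩ * ⟨x, hx⟩) = ⟨x, hx⟩ * (⟨y, hy⟩ * ⟨x, hx⟩) := by
      rw [mul_assoc, hb]
    exact congrArg Subtype.val e

/-! ### Idempotence and irreducible entries -/

namespace IsUniqueNonassocTriple

variable {a b c : A}

theorem dual (h : IsUniqueNonassocTriple A a b c) :
    @IsUniqueNonassocTriple A (dualMul A) c b a :=
  @IsUniqueNonassocTriple.mk A (dualMul A) _ _ _ h.ne.symm fun x y z hne =>
    (h.assoc z y x fun ⟨h₁, h₂, h₃⟩ => hne ⟨h₃, h₂, h₁⟩).symm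

theorem not_proj_left (h : IsUniqueNonassocTriple A a b c) : ¬∀ x y : A, x * y = x :=
  fun e => h.ne (by simp only [e])

theorem not_proj_right (h : IsUniqueNonassocTriple A a b c) : ¬∀ x y : A, x * y = y :=
  fun e => h.ne (by simp only [e])

theorem false_of_subsingleton (h : IsUniqueNonassocTriple A a b c) (hs : ∀ y : A, y = b) : False :=
  h.ne ((hs _).trans (hs _).symm)

/-- Otherwise squaring generates the clone, so `xy` depends on one variable only. Then neither side
of associativity at `(a, y, c)` depends on `y`, which forces `y = b` for all `y`. -/
theorem idem (h : IsUniqueNonassocTriple A a b c) (hmin : HasMinimalClone A) (x : A) :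
    x * x = x := by
  have hg : (fun x : Fin 2 → A => x 0 * x 0) ∈ (ofBinary (fun x y : A => x * y)).ops 1 :=
    ⟨FreeMagma.of 0 * FreeMagma.of 0, rfl⟩
  rcases IsMinimal.trivial_or_eq (m := fun x y : A => x * y) (g := fun x _ : A => x * x) hmin hg with e | e | e
  · exact e x x
  · exact e x x
  · exfalso
    have hm := self_mem_ofBinary (fun x y : A => x * y)
    rw [← e] at hm
    have := mem_of_mem_ofBinary
      {p | (∃ φ : A → A, p = fun x _ => φ x) ∨ ∃ φ : A → A, p = fun _ y => φ y}
      (Or.inl ⟨id, rfl⟩) (Or.inr ⟨id, rfl⟩) ?_ hm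
    · rcases this with ⟨φ, hφ⟩ | ⟨φ, hφ⟩
      · have hφ' : ∀ x y : A, x * y = φ x := fun x y => congrFun (congrFun hφ x) y
        refine h.false_of_subsingleton fun y => ?_
        by_contra hy
        have e := h.assoc a y c (fun h => hy h.2.1)
        have ne := h.ne
        simp only [hφ'] at e ne
        exact ne e
      · have hφ' : ∀ x y : A, x * y = φ y := fun x y => congrFun (congrFun hφ x) y
        refine h.false_of_subsingleton fun y => ?_
        by_contra hy
        have e := h.assoc a y c (fun h => hy h.2.1)
        have ne := h.ne
        simp only [hφ'] at e ne
        exact ne e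
    · rintro p (⟨φ, rfl⟩ | ⟨φ, rfl⟩) q -
      · exact Or.inl ⟨fun x => φ x * φ x, rfl⟩
      · exact Or.inr ⟨fun x => φ x * φ x, rfl⟩

/-- The middle entry of the nonassociative triple is irreducible. -/
theorem eq_or_eq_of_mul_eq_mid (h : IsUniqueNonassocTriple A a b c) {u v : A} (huv : u * v = b) :
    u = b ∨ v = b := by
  by_contra! hne
  obtain ⟨hu, hv⟩ := hne
  apply h.ne
  -- Every triple reassociated here has middle entry `u` or `v`, never `b`.
  rw [← huv, ← h.assoc a u v (by tauto), h.assoc (a * u) v c (by tauto),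
    h.assoc a u (v * c) (by tauto), h.assoc u v c (by tauto)]

/-- The first entry of the nonassociative triple is irreducible unless the last two agree. -/
theorem eq_or_eq_of_mul_eq_left (h : IsUniqueNonassocTriple A a b c) (hbc : b ≠ c) {u v : A}
    (huv : u * v = a) : u = a ∨ v = a := by
  by_contra! hne
  obtain ⟨hu, hv⟩ := hne
  apply h.ne
  rw [← huv, h.assoc u v b (by tauto), h.assoc u (v * b) c (by tauto), h.assoc v b c (by tauto),
    h.assoc u v (b * c) (by tauto)]

theorem eq_or_eq_of_mul_eq_right (h : IsUniqueNonassocTriple A a b c) (hab : a ≠ b) {u v : A}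
    (huv : u * v = c) : u = c ∨ v = c :=
  (@eq_or_eq_of_mul_eq_left A (dualMul A) _ _ _ h.dual hab.symm v u huv).symm

/-- The elements different from a given irreducible element. -/
def compl (d : A) (hd : ∀ u v : A, u * v = d → u = d ∨ v = d) : Subsemigroup A where
  carrier := {x | x ≠ d}
  mul_mem' := fun {u v} hu hv huv => (hd u v huv).elim hu hv

theorem pair_of_ne (h : IsUniqueNonassocTriple A a b c) (hi : ∀ x : A, x * x = x) {d : A}
    (hd : ∀ u v : A, u * v = d → u = d ∨ v = d) (hmem : d = a ∨ d = b ∨ d = c) {x y : A}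
    (hx : x ≠ d) (hy : y ≠ d) : SandwichB x y ∧ (x * y) * (y * x) = x * (y * x) := by
  refine pair_of_subsemigroup hi (compl d hd) (fun u hu v hv w hw => h.assoc u v w ?_) hx hy
  rintro ⟨rfl, rfl, rfl⟩
  rcases hmem with rfl | rfl | rfl
  exacts [hu rfl, hv rfl, hw rfl]

/-! ### Three distinct entries -/

theorem pair_of_distinct (h : IsUniqueNonassocTriple A a b c) (hi : ∀ x : A, x * x = x)
    (hab : a ≠ b) (hbc : b ≠ c) (hac : a ≠ c) (x y : A) :
    SandwichB x y ∧ (x * y) * (y * x) = x * (y * x) := by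
  have ha := pair_of_ne h hi (d := a) (fun u v => h.eq_or_eq_of_mul_eq_left hbc) (by simp)
    (x := x) (y := y)
  have hb := pair_of_ne h hi (d := b) (fun u v => h.eq_or_eq_of_mul_eq_mid) (by simp)
    (x := x) (y := y)
  have hc := pair_of_ne h hi (d := c) (fun u v => h.eq_or_eq_of_mul_eq_right hab) (by simp)
    (x := x) (y := y)
  by_cases h₁ : x ≠ a ∧ y ≠ a
  · exact ha h₁.1 h₁.2
  by_cases h₂ : x ≠ b ∧ y ≠ b
  · exact hb h₂.1 h₂.2
  refine hc ?_ ?_ <;> rintro rfl <;> grind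

theorem inVarietyB_of_distinct (h : IsUniqueNonassocTriple A a b c) (hmin : HasMinimalClone A)
    (hab : a ≠ b) (hbc : b ≠ c) (hac : a ≠ c) : InVarietyB A ∨ @InVarietyB A (dualMul A) := by
  have hi := h.idem hmin
  have hp := h.pair_of_distinct hi hab hbc hac
  have hll : ∀ x y : A, x * (x * y) = x * y := fun x y => by
    rw [← h.assoc x x y (by grind), hi]
  have hrr : ∀ x y : A, x * y * y = x * y := fun x y => by
    rw [h.assoc x y y (by grind), hi]
  have hflex : ∀ x y : A, x * y * x = x * (y * x) := fun x y => h.assoc x y x (by grind)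
  rcases hmin.of_sandwich (inVarietyB_sandwich hi fun x y => (hp x y).1) with e | e | e
  · exact Or.inl ⟨hi, hll, fun x y => (e x y).symm, fun x y => (hflex x y).trans (e x y).symm, hrr,
      fun x y => (hp x y).2.trans (e x y).symm⟩
  · exact Or.inr (@InVarietyB.mk A (dualMul A) hi (fun x y => hrr y x)
      (fun x y => (hflex x y).trans (e y x).symm) (fun x y => (e y x).symm) (fun x y => hll y x)
      (fun x y => (hp x y).2.trans (e y x).symm))
  -- Irreducibility makes any two of `a, b, c` a left-zero or right-zero pair. In each of the eight
  -- cases `(a,b,c)` associates or `(c,b,a)` does not.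
  · exfalso
    have key : ∀ x y : A, x * y * (y * x) = x := fun x y => (hp x y).2.trans (e x y)
    have dich : ∀ x y : A, (x * y = x ∨ y * x = x) →
        (x * y = x ∧ y * x = y) ∨ (x * y = y ∧ y * x = x) := by
      rintro x y (hxy | hyx)
      · exact Or.inl ⟨hxy, by have := e y x; rwa [hxy] at this⟩
      · refine Or.inr ⟨?_, hyx⟩
        have := hflex y x
        rwa [hyx, e y x] at this
    have dab := dich a b (h.eq_or_eq_of_mul_eq_left hbc (key a b))
    have dac := dich a c (h.eq_or_eq_of_mul_eq_left hbc (key a c))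
    have dbc := dich b c (h.eq_or_eq_of_mul_eq_mid (key b c))
    have hne := h.ne
    have hcba := h.assoc c b a (by tauto)
    rcases dab with ⟨h₁, h₂⟩ | ⟨h₁, h₂⟩ <;> rcases dac with ⟨h₃, h₄⟩ | ⟨h₃, h₄⟩ <;>
      rcases dbc with ⟨h₅, h₆⟩ | ⟨h₅, h₆⟩ <;>
      simp_all

/-! ### Equal outer entries -/

theorem false_of_outer_eq_of_ne (h : IsUniqueNonassocTriple A a b a) (hmin : HasMinimalClone A)
    (hab : a ≠ b) (ha : b * a ≠ a) (hb : b * a ≠ b) : False := by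
  have hi := h.idem hmin
  have as₁ : ∀ x y z : A, x ≠ a → x * y * z = x * (y * z) := fun x y z hx => h.assoc x y z (by tauto)
  have as₂ : ∀ x y z : A, y ≠ b → x * y * z = x * (y * z) := fun x y z hx => h.assoc x y z (by tauto)
  have as₃ : ∀ x y z : A, z ≠ a → x * y * z = x * (y * z) := fun x y z hx => h.assoc x y z (by tauto)
  have hll : ∀ x y : A, x * (x * y) = x * y := fun x y => by
    rw [← h.assoc x x y (by grind), hi]
  have hrr : ∀ x y : A, x * y * y = x * y := fun x y => by
    rw [h.assoc x y y (by grind), hi]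
  -- Only the pair `a, b` lies in neither band, so its identities are checked by hand; `q` and `r`
  -- are its two sandwich products.
  obtain ⟨f, hf⟩ : ∃ f, f = b * a := ⟨_, rfl⟩
  obtain ⟨q, hq⟩ : ∃ q, q = a * f := ⟨_, rfl⟩
  obtain ⟨r, hr⟩ : ∃ r, r = f * b := ⟨_, rfl⟩
  rw [← hf] at ha hb
  have hr' : r = b * (a * b) := by rw [hr, hf, as₁ _ _ _ hab.symm]
  have gab : sandwich a b = q := by rw [sandwich, hq, hf]
  have gba : sandwich b a = r := by rw [sandwich, hr']
  have fa : f * a = f := by rw [hf, hrr]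
  have aq : a * q = q := by rw [hq, hll]
  have qa : q * a = q := by rw [hq, as₂ _ _ _ hb, fa]
  have rb : r * b = r := by rw [hr, hrr]
  have br : b * r = r := by rw [hr', hll]
  have ra : r * a = f := by rw [hr, as₁ _ _ _ ha, ← hf, hi]
  have bq : b * q = f := by rw [hq, ← as₁ _ _ _ hab.symm, ← hf, hi]
  have qf : q * f = q := by rw [hq, hrr]
  have fr : f * r = r := by rw [hr, hll]
  have rq : r * q = f := by rw [hq, ← as₂ _ _ _ hab, ra, hi]
  have rar : r * (a * r) = r := by rw [← as₂ _ _ _ hab, ra, fr]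
  have qr : q * r = a * r := by rw [hq, as₂ _ _ _ hb, fr]
  have sab : SandwichB a b := by
    constructor <;> rw [gab]
    · rw [sandwich, qa, aq]
    · rw [gba, sandwich, ra, hq]
    · rw [sandwich, aq, hi]
    · rw [sandwich, bq, qf]
    · rw [gba, sandwich, rq, qf]
  have sba : SandwichB b a := by
    constructor <;> rw [gba]
    · rw [sandwich, rb, br]
    · rw [gab, sandwich, ← as₁ _ _ _ hab.symm, bq, hr]
    · rw [sandwich, br, hi]
    · rw [sandwich, rar]
    · rw [gab, sandwich, qr, rar]
  have hs : ∀ x y : A, SandwichB x y := by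
    intro x y
    have hp₁ := pair_of_ne h hi (d := a) (fun u v => h.eq_or_eq_of_mul_eq_left hab.symm) (by simp)
      (x := x) (y := y)
    have hp₂ := pair_of_ne h hi (d := b) (fun u v => h.eq_or_eq_of_mul_eq_mid) (by simp)
      (x := x) (y := y)
    by_cases h₁ : x ≠ a ∧ y ≠ a
    · exact (hp₁ h₁.1 h₁.2).1
    by_cases h₂ : x ≠ b ∧ y ≠ b
    · exact (hp₂ h₂.1 h₂.2).1
    have : (x = a ∧ y = b) ∨ (x = b ∧ y = a) := by grind
    rcases this with ⟨rfl, rfl⟩ | ⟨rfl, rfl⟩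
    exacts [sab, sba]
  apply h.ne
  rw [← hf, ← hq]
  rcases hmin.of_sandwich (inVarietyB_sandwich hi hs) with e | e | e
  · rw [e a b, ← hf, ← hq, qa]
  · have hfq : f = q := by rw [hq, hf, ← e b a]
    rw [e a b, ← hr', ra, hfq]
  · exfalso
    -- By irreducibility and `ba ∉ {a, b}`, `ab` would equal both `a` and `b`.
    have e₁ : (a * b) * (b * a) = a := by rw [as₃ _ _ _ (hf ▸ ha), hll, e]
    have e₂ : (b * a) * (a * b) = b := by rw [as₁ _ _ _ hab.symm, hll, e]
    have d₁ := h.eq_or_eq_of_mul_eq_left hab.symm e₁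
    have d₂ := h.eq_or_eq_of_mul_eq_mid e₂
    rw [← hf] at d₁ d₂
    exact hab ((d₁.resolve_right ha).symm.trans (d₂.resolve_left hb))

theorem false_of_outer_eq (h : IsUniqueNonassocTriple A a b a) (hmin : HasMinimalClone A)
    (hab : a ≠ b) : False := by
  by_cases h₁ : b * a ≠ a ∧ b * a ≠ b
  · exact h.false_of_outer_eq_of_ne hmin hab h₁.1 h₁.2
  by_cases h₂ : a * b ≠ a ∧ a * b ≠ b
  · exact @false_of_outer_eq_of_ne A (dualMul A) _ _ h.dual (hasMinimalClone_dual_iff.2 hmin) hab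
      h₂.1 h₂.2
  have hi := h.idem hmin
  have hia := hi a
  have hne := h.ne
  have d₁ : b * a = a ∨ b * a = b := by tauto
  have d₂ : a * b = a ∨ a * b = b := by tauto
  rcases d₁ with d₁ | d₁ <;> rcases d₂ with d₂ | d₂ <;> simp [d₁, d₂, hia] at hne

/-! ### Equal first two entries -/

/-- The operation `x(xy)` is associative if the first two entries agree. -/
theorem left_left_assoc (h : IsUniqueNonassocTriple A a a b) (hi : ∀ x : A, x * x = x)
    (hab : a ≠ b) (hca : a * (a * b) ≠ a) (hda : a * b ≠ a) (hdb : a * b ≠ b) (x y z : A) :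
    x * (x * y) * (x * (x * y) * z) = x * (x * (y * (y * z))) := by
  have as₁ : ∀ x y z : A, x ≠ a → x * y * z = x * (y * z) := fun x y z hx => h.assoc x y z (by tauto)
  have as₂ : ∀ x y z : A, y ≠ a → x * y * z = x * (y * z) := fun x y z hx => h.assoc x y z (by tauto)
  have as₃ : ∀ x y z : A, z ≠ b → x * y * z = x * (y * z) := fun x y z hx => h.assoc x y z (by tauto)
  -- `x(xy)` can differ from `xy` only at `(a, b)`; the case splits locate where that pair occurs.
  have hll₁ : ∀ x y : A, x ≠ a → x * (x * y) = x * y := fun x y hx => by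
    rw [← as₁ x x y hx, hi]
  have hll₂ : ∀ x y : A, y ≠ b → x * (x * y) = x * y := fun x y hy => by
    rw [← as₃ x x y hy, hi]
  by_cases hxy : x = a ∧ y = b
  · obtain ⟨rfl, rfl⟩ := hxy
    rw [hll₁ _ z hca, hll₁ y z hab.symm, ← as₂ x y z hab.symm, ← as₂ _ _ z hda]
  have hfxy : x * (x * y) = x * y := by
    by_cases hx : x = a
    exacts [hll₂ x y fun hy => hxy ⟨hx, hy⟩, hll₁ x y hx]
  rw [hfxy]
  by_cases hxyz : x * y = a ∧ z = b
  · obtain ⟨hxy', rfl⟩ := hxyz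
    rw [hxy']
    by_cases hy : y = a
    · subst hy
      have : x * (y * (y * z)) = y * (y * z) := by
        rw [← as₃ x y _ hdb, hxy']
      rw [this, this]
    · have hx : x = a := (h.eq_or_eq_of_mul_eq_left hab hxy').resolve_right hy
      subst hx
      rw [hll₁ y z hy, ← as₂ x y z hy, hxy']
  have hl : x * y * (x * y * z) = x * y * z := by
    by_cases hu : x * y = a
    exacts [hll₂ _ z fun hz => hxyz ⟨hu, hz⟩, hll₁ _ z hu]
  rw [hl]
  by_cases hyz : y = a ∧ z = b
  · obtain ⟨rfl, rfl⟩ := hyz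
    have hxa : x * y ≠ y := fun e => hxyz ⟨e, rfl⟩
    have hx : x ≠ y := fun e => hxa (by rw [e, hi])
    rw [hll₁ x _ hx, ← as₃ x y _ hdb, ← as₁ (x * y) y z hxa, as₁ x y y hx, hi]
  have hr : y * (y * z) = y * z := by
    by_cases hy : y = a
    exacts [hll₂ y z fun hz => hyz ⟨hy, hz⟩, hll₁ y z hy]
  have hassoc : x * y * z = x * (y * z) := h.assoc x y z (by tauto)
  rw [hr, ← hassoc]
  by_cases hx : x = a
  · rw [← h.assoc x (x * y) z (by tauto), hfxy]
  · rw [hassoc, hll₁ x _ hx]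

theorem false_of_left_eq (h : IsUniqueNonassocTriple A a a b) (hmin : HasMinimalClone A) :
    False := by
  have hi := h.idem hmin
  have hne : a * b ≠ a * (a * b) := by simpa only [hi] using h.ne
  have hab : a ≠ b := by
    rintro rfl
    simp [hi] at hne
  have hda : a * b ≠ a := fun e => by simp [e, hi] at hne
  have hdb : a * b ≠ b := fun e => by simp [e] at hne
  have hdd : a * b * b = a * b := by rw [h.assoc a b b (by tauto), hi]
  have hcb' : a * (a * b) * b = a * (a * b) := by rw [h.assoc a (a * b) b (by tauto), hdd]
  have hca : a * (a * b) ≠ a := fun e => by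
    rw [e] at hcb'
    exact hda hcb'
  have hac : a * (a * (a * b)) = a * (a * b) := by rw [← h.assoc a a (a * b) (by tauto), hi]
  have hcb : a * (a * b) ≠ b := fun e => by
    rw [e] at hac
    exact hdb hac
  rcases IsMinimal.trivial_or_eq (m := fun x y : A => x * y) (g := fun x y => x * (x * y)) hmin
    term_mem_left_left with e | e | e
  · exact hca (e a b)
  · exact hcb (e a b)
  · have hm := self_mem_ofBinary (fun x y : A => x * y)
    rw [← e] at hm
    have hmin' : (ofBinary fun x y : A => x * (x * y)).IsMinimal := e ▸ hmin
    rcases @mem_ofBinary_of_band A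
      { mul := fun x y => x * (x * y), mul_assoc := h.left_left_assoc hi hab hca hda hdb }
      (fun x => (congrArg (x * ·) (hi x)).trans (hi x)) hmin' _ hm with e | e | e | e
    · exact h.not_proj_left e
    · exact h.not_proj_right e
    · exact hne (e a b)
    -- If the multiplication is the swap, then `ab = b(ba) = ba = a(ab)`.
    · have e₁ : a * b = b * (b * a) := e a b
      have e₂ : b * a = a * (a * b) := e b a
      rw [← h.assoc b b a (by tauto), hi, e₂] at e₁
      exact hne e₁

theorem inVarietyB_or_dual (h : IsUniqueNonassocTriple A a b c) (hmin : HasMinimalClone A) :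
    InVarietyB A ∨ @InVarietyB A (dualMul A) := by
  rcases eq_or_ne a b with rfl | hab
  · exact (h.false_of_left_eq hmin).elim
  rcases eq_or_ne b c with rfl | hbc
  · exact (@false_of_left_eq A (dualMul A) _ _ h.dual (hasMinimalClone_dual_iff.2 hmin)).elim
  rcases eq_or_ne a c with rfl | hac
  · exact (h.false_of_outer_eq hmin hab).elim
  exact h.inVarietyB_of_distinct hmin hab hbc hac

end IsUniqueNonassocTriple

end

/-- The dual of the groupoid `A` is its multiplicative opposite `Aᵐᵒᵖ`. -/
theorem theorem3p3 {A : Type u} [Mul A] (hA : IsSzaszHajek A) :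
    HasMinimalClone A ↔ (InVarietyB A ∨ InVarietyB (MulOpposite A)) := by
  obtain ⟨a, b, c, h⟩ := hA.exists_triple
  rw [← inVarietyB_dual_iff]
  refine ⟨h.inVarietyB_or_dual, ?_⟩
  rintro (hB | hB)
  · exact hB.hasMinimalClone h.not_proj_left h.not_proj_right
  · exact hasMinimalClone_dual_iff.1 (@InVarietyB.hasMinimalClone A (dualMul A) hB
      (fun e => h.not_proj_right fun x y => e y x) (fun e => h.not_proj_left fun x y => e y x))
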